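/- Let $\vec G$ be a finite directed graph without loops and let $P$ be a probability distribution on $V=V(\vec G)$. For $t\ge 1$ let $\vec G^{\wedge t}$ (the $t$-th AND power) be the digraph on $V^t$ in which $(x,y)$ is an edge iff $x\ne y$ and for every coordinate $i$ either $x_i=y_i$ or $(x_i,y_i)$ is an edge of $\vec G$. For $\varepsilon>0$ let $\mathcal T^t(P,\varepsilon)$ be the set of all $x\in V^t$ such that $\left|\frac1t|\{i: x_i=a\}|-P(a)\right|<\varepsilon$ for every $a\in V$, and let $\vec G^{\wedge t}_{P,\varepsilon}$ be the subgraph of $\vec G^{\wedge t}$ induced on $\mathcal T^t(P,\varepsilon)$. For a digraph $\vec F$ let $\chi(\vec F)$ and $\alpha(\vec F)$ be the chromatic number and the independence number of its underlying undirected graph. All logarithms are to base $2$ (the set $\mathcal T^t(P,\varepsilon)$ is non-empty for all large $t$). Define the Dilworth rate and the Sperner capacity within type $P$ by $$R_{\rm D}(\vec G,P)=\lim_{\varepsilon\to0^+}\limsup_{t\to\infty}\frac1t\log\chi\bigl(\vec G^{\wedge t}_{P,\varepsilon}\bigr),\qquad \Gamma(\vec G,P)=\lim_{\varepsilon\to0^+}\limsup_{t\to\infty}\frac1t\log\alpha\bigl(\vec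 G^{\wedge t}_{P,\varepsilon}\bigr).$$ Then both limits as $\varepsilon\to0^+$ exist, and $$R_{\rm D}(\vec G,P)+\Gamma(\vec G,P)=H(P),$$ where $H(P)=-\sum_{a\in V}P(a)\log P(a)$ (with $0\log 0=0$) is the entropy of $P$. (For symmetric digraphs, i.e. undirected graphs, this is Marton's identity for the complementary graph entropy.) -/

import Mathlib

open Filter Topology

namespace Digraph

/-- The `t`-th AND power of a loopless digraph: there is an edge from `x` to a different sequence
`y` iff in every coordinate either the two letters agree or there is an edge from `x i` to `y i`. -/
def andPow {V : Type*} (G : Digraph V) (t : ℕ) : Digraph (Fin t → V) where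
  Adj x y := x ≠ y ∧ ∀ i, x i = y i ∨ G.Adj (x i) (y i)

/-- The digraph induced by `G` on the vertex subset `U`. -/
def inducedOn {V : Type*} (G : Digraph V) (U : Set V) : Digraph U where
  Adj x y := G.Adj x.1 y.1

/-- The chromatic number of (the underlying undirected graph of) a finite digraph. -/
noncomputable def chromNum {V : Type*} (G : Digraph V) : ℕ :=
  G.toSimpleGraphInclusive.chromaticNumber.toNat

/-- The independence number of (the underlying undirected graph of) a finite digraph. -/
noncomputable def indepNum {V : Type*} (G : Digraph V) : ℕ :=
  G.toSimpleGraphInclusive.indepNum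

/-- The set of `(P, ε)`-typical sequences of length `t`: the relative frequency of every letter `a`
differs from `P a` by less than `ε`. -/
def typicalSet {V : Type*} [DecidableEq V] (P : V → ℝ) (ε : ℝ) (t : ℕ) : Set (Fin t → V) :=
  {x | ∀ a, |((Finset.univ.filter fun i => x i = a).card : ℝ) / t - P a| < ε}

/-- `limsup_{t → ∞} (1/t) log₂ β(G^{∧t}[T^t(P, ε)])` for a graph parameter `β`,
taken in the extended reals. -/
noncomputable def typicalExponent.{u} (β : ∀ {W : Type u}, Digraph W → ℕ) {V : Type u} [DecidableEq V]
    (G : Digraph V) (P : V → ℝ) (ε : ℝ) : EReal :=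
  limsup (fun t : ℕ =>
    ((Real.logb 2 (β ((G.andPow t).inducedOn (typicalSet P ε t))) / t : ℝ) : EReal)) atTop

/-- The Dilworth rate of `G` within type `P`: the limit as `ε → 0` of the exponents belonging to
the chromatic number. -/
noncomputable def dilworthRateWithin {V : Type*} [DecidableEq V] (G : Digraph V) (P : V → ℝ) :
    EReal :=
  limUnder (𝓝[>] (0 : ℝ)) (typicalExponent chromNum G P)

/-- The Sperner capacity of `G` within type `P`, in terms of AND powers: the limit as `ε → 0` of
the exponents belonging to the independence number. -/
noncomputable def spernerCapacityWithin {V : Type*} [DecidableEq V] (G : Digraph V) (P : V → ℝ) :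
    EReal :=
  limUnder (𝓝[>] (0 : ℝ)) (typicalExponent indepNum G P)

/-- The entropy in base 2; `0 * log 0` is `0`. -/
noncomputable def entropyTwo {V : Type*} [Fintype V] (P : V → ℝ) : ℝ :=
  -∑ a, P a * Real.logb 2 (P a)

end Digraph

/-!
The lower bound `H(P) ≤ R_D + Γ` holds since the chromatic number times the independence number of
a graph is at least its number of vertices (`card_le_chromNum_mul_indepNum`), and a typical set
contains type classes (sets of all words with prescribed letter counts) of size
`2 ^ (t (H(P) - o(1)))` by Stirling's formula (`le_logb_card_typeClass`).

For the upper bound, the permutations of the positions act transitively on each type class by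
automorphisms of the AND power. Hence a greedy choice covers the class `T` by about
`#T / #A * log #T` permuted copies of an independent set `A` in it (`exists_cover_typeClass`), and
since there are only polynomially many types, the exponent of the chromatic number is at most the
largest value of `(log #T - log #A) / t` over types close to `P`, with `A` of maximal size. Here
`log #T ≤ t (H(P) + o(1))` (`logb_card_typeClass_le`), so what remains is to show that *every* type
class of a type close to `P`, for *every* large length `t`, has an independent set of size at least
`2 ^ (t (Γ - o(1)))` (`exists_le_logb_codeNum`), although `Γ` is defined by an upper limit and by
the union of many type classes. By the pigeonhole principle there is one length `s` and one type `n`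
of that length with an independent set of about that size. Any type that dominates `k • n` has an
independent set of size at least the `k`-th power of that size: concatenate `k` words and fill up
with a fixed word (`codeNum_pow_le`). A type `m` close to `P` dominates almost `t / s` copies of `n`
unless `n` uses letters outside the support of `P`. Such letters are rare in `n`, so fixing their
positions and values costs only a small exponent (`codeNum_le_mul_codeNum`), after which they can be
replaced by a letter of the support.
-/

namespace Digraph

open Finset

/-! ### Types of words -/

/-- The type (composition) of a word `x`: the number of occurrences of each letter. -/
def wordType {ι V : Type*} [Fintype ι] [DecidableEq V] (x : ι → V) (a : V) : ℕ :=
  #{i | x i = a}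

/-- The set of all words with a given number of occurrences of each letter. -/
def typeClass {V : Type*} [Fintype V] [DecidableEq V] (ι : Type*) [Fintype ι] [DecidableEq ι]
    (n : V → ℕ) : Finset (ι → V) :=
  {x | wordType x = n}

section Types

variable {ι κ V : Type*} [Fintype ι] [Fintype κ] [DecidableEq V]

theorem mem_typeClass [Fintype V] [DecidableEq ι] {n : V → ℕ} {x : ι → V} :
    x ∈ typeClass ι n ↔ wordType x = n := by
  simp [typeClass]

theorem sum_wordType [Fintype V] (x : ι → V) : ∑ a, wordType x a = Fintype.card ι :=
  (Finset.card_eq_sum_card_fiberwise (f := x) (s := univ) (t := univ) (by simp)).symm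

theorem wordType_le_card (x : ι → V) (a : V) : wordType x a ≤ Fintype.card ι :=
  Finset.card_le_univ _

theorem prod_comp_word [Fintype V] {M : Type*} [CommMonoid M] (f : V → M) (x : ι → V) :
    ∏ i, f (x i) = ∏ a, f a ^ wordType x a := by
  rw [← Finset.prod_fiberwise' univ x f]
  simp [wordType]

theorem wordType_comp_equiv (x : ι → V) (e : κ ≃ ι) : wordType (x ∘ e) = wordType x := by
  funext a
  simp only [wordType, ← Fintype.card_subtype]
  exact Fintype.card_congr (e.subtypeEquiv fun _ => Iff.rfl)

/-- Two words of the same type differ by a bijection of their positions. -/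
theorem exists_equiv_of_wordType_eq {x : ι → V} {y : κ → V} (h : wordType x = wordType y) :
    ∃ e : κ ≃ ι, x ∘ e = y := by
  have hc : ∀ a, Nonempty ({j // y j = a} ≃ {i // x i = a}) := fun a => by
    refine ⟨Fintype.equivOfCardEq ?_⟩
    simpa only [wordType, ← Fintype.card_subtype] using (congrFun h a).symm
  exact ⟨Equiv.ofFiberEquiv fun a => (hc a).some, funext fun j => Equiv.ofFiberEquiv_map _ j⟩

theorem wordType_sumElim (x : ι → V) (y : κ → V) :
    wordType (Sum.elim x y) = wordType x + wordType y := by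
  funext a
  simp only [wordType, Pi.add_apply, ← Fintype.card_subtype, ← Fintype.card_sum]
  exact Fintype.card_congr (Equiv.subtypeSum)

theorem exists_wordType_eq [Fintype V] {n : V → ℕ} (h : ∑ a, n a = Fintype.card ι) :
    ∃ x : ι → V, wordType x = n := by
  have e : ι ≃ Σ a, Fin (n a) := Fintype.equivOfCardEq (by simp [h])
  refine ⟨Sigma.fst ∘ e, ?_⟩
  rw [wordType_comp_equiv]
  funext a
  simp only [wordType, ← Fintype.card_subtype]
  rw [Fintype.card_congr (Equiv.sigmaSubtype a)]
  simp

variable [DecidableEq ι]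

/-- The permutations of positions carrying one word to another of the same type form a coset of
the stabilizer, which is a product of symmetric groups. -/
theorem card_perm_comp_eq [Fintype V] {x y : ι → V} (h : wordType x = wordType y) :
    #{g : Equiv.Perm ι | x ∘ g = y} = ∏ a, (wordType x a).factorial := by
  obtain ⟨e, rfl⟩ := exists_equiv_of_wordType_eq h
  have h1 := DomMulAct.stabilizer_card x
  simp only [wordType, ← Fintype.card_subtype]
  rw [← h1]
  refine Fintype.card_congr ((Equiv.mulRight e⁻¹).subtypeEquiv fun g => ?_)
  simp only [Equiv.coe_mulRight, Equiv.Perm.coe_mul, ← Function.comp_assoc]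
  constructor
  · intro hg
    rw [hg]
    funext i
    simp
  · intro hg
    conv_rhs => rw [← hg]
    funext i
    simp

/-- The number of words of a type is a multinomial coefficient. -/
theorem card_typeClass_mul [Fintype V] {n : V → ℕ} (h : ∑ a, n a = Fintype.card ι) :
    #(typeClass ι n) * ∏ a, (n a).factorial = (Fintype.card ι).factorial := by
  obtain ⟨x, rfl⟩ := exists_wordType_eq (ι := ι) h
  rw [← Fintype.card_perm, ← Finset.card_univ (α := Equiv.Perm ι)]
  rw [Finset.card_eq_sum_card_fiberwise (f := fun g : Equiv.Perm ι => x ∘ g)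
    (t := typeClass ι (wordType x))]
  · rw [Finset.sum_congr rfl fun y hy => card_perm_comp_eq (mem_typeClass.1 hy).symm]
    simp
  · intro g _
    exact mem_typeClass.2 (wordType_comp_equiv x g)

/-- The number of words of a type is at most the inverse of the probability of each of them under
the product distribution of that type. -/
theorem card_typeClass_mul_prod_le_one [Fintype V] (n : V → ℕ) (hn : ∑ a, n a = Fintype.card ι)
    (hι : 0 < Fintype.card ι) :
    (#(typeClass ι n) : ℝ) * ∏ a, ((n a : ℝ) / Fintype.card ι) ^ n a ≤ 1 := by
  set q : V → ℝ := fun a => (n a : ℝ) / Fintype.card ι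
  have hq : ∑ a, q a = 1 := by
    rw [← Finset.sum_div, ← Nat.cast_sum, hn, div_self (by positivity)]
  calc (#(typeClass ι n) : ℝ) * ∏ a, q a ^ n a
      = ∑ x ∈ typeClass ι n, ∏ i, q (x i) := by
        rw [Finset.sum_congr rfl fun x hx => by
          rw [prod_comp_word q x, mem_typeClass.1 hx]]
        simp
    _ ≤ ∑ x : ι → V, ∏ i, q (x i) :=
        Finset.sum_le_univ_sum_of_nonneg fun x => Finset.prod_nonneg fun i _ => by positivity
    _ = ∏ _i : ι, ∑ a, q a := by
        rw [Finset.prod_univ_sum (fun _ => univ) fun _ a => q a, Fintype.piFinset_univ]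
    _ = 1 := by simp [hq]

end Types

/-! ### Sizes of type classes -/

section Entropy

variable {ι V : Type*} [Fintype ι] [DecidableEq ι] [Fintype V]

theorem entropyTwo_eq_sum_negMulLog (P : V → ℝ) :
    entropyTwo P = (∑ a, Real.negMulLog (P a)) / Real.log 2 := by
  simp only [entropyTwo, Real.negMulLog, Real.logb, Finset.sum_div, ← Finset.sum_neg_distrib]
  exact Finset.sum_congr rfl fun a _ => by ring

theorem continuous_entropyTwo : Continuous (entropyTwo : (V → ℝ) → ℝ) := by
  have : (entropyTwo : (V → ℝ) → ℝ) = fun P => (∑ a, Real.negMulLog (P a)) / Real.log 2 :=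
    funext entropyTwo_eq_sum_negMulLog
  rw [this]
  exact (continuous_finsetSum _ fun a _ =>
    Real.continuous_negMulLog.comp (continuous_apply a)).div_const _

/-- The probability of a word of type `n` under the product distribution of that type. -/
theorem logb_prod_pow_type (n : V → ℕ) {t : ℕ} (ht : 0 < t) :
    Real.logb 2 (∏ a, ((n a : ℝ) / t) ^ n a) = -(t * entropyTwo fun a => (n a : ℝ) / t) := by
  have ht' : (t : ℝ) ≠ 0 := by positivity
  rw [Real.logb_prod, entropyTwo, mul_neg, neg_neg, Finset.mul_sum]
  · refine Finset.sum_congr rfl fun a _ => ?_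
    rw [Real.logb_pow]
    field_simp
  · intro a _
    rcases Nat.eq_zero_or_pos (n a) with h | h
    · simp [h]
    · positivity

theorem prod_pow_type_pos (n : V → ℕ) {t : ℕ} (ht : 0 < t) :
    0 < ∏ a, ((n a : ℝ) / t) ^ n a := by
  refine Finset.prod_pos fun a _ => ?_
  rcases Nat.eq_zero_or_pos (n a) with h | h
  · simp [h]
  · positivity

variable [DecidableEq V]

theorem card_typeClass_pos (n : V → ℕ) (hn : ∑ a, n a = Fintype.card ι) :
    0 < #(typeClass ι n) := by
  obtain ⟨x, hx⟩ := exists_wordType_eq (ι := ι) hn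
  exact Finset.card_pos.2 ⟨x, mem_typeClass.2 hx⟩

theorem logb_card_typeClass_le (n : V → ℕ) (hn : ∑ a, n a = Fintype.card ι)
    (hι : 0 < Fintype.card ι) :
    Real.logb 2 #(typeClass ι n) ≤
      Fintype.card ι * entropyTwo fun a => (n a : ℝ) / Fintype.card ι := by
  have h := card_typeClass_mul_prod_le_one n hn hι
  have hp := prod_pow_type_pos n hι
  have hc : (0 : ℝ) < #(typeClass ι n) := by exact_mod_cast card_typeClass_pos n hn
  have h2 := Real.logb_nonpos (b := 2) (by norm_num) (by positivity) h
  rw [Real.logb_mul hc.ne' hp.ne', logb_prod_pow_type n hι] at h2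
  linarith

/-- A weak form of Stirling's upper bound that also holds for `n = 0`. -/
theorem factorial_le_exp_mul (n : ℕ) :
    (n.factorial : ℝ) ≤ Real.exp 1 * (n + 1) * (n / Real.exp 1) ^ n := by
  rcases n with _ | n
  · simp
  have h : Stirling.stirlingSeq (n + 1) ≤ Stirling.stirlingSeq 1 :=
    Stirling.stirlingSeq'_antitone (Nat.zero_le n)
  rw [Stirling.stirlingSeq_one, Stirling.stirlingSeq, div_le_iff₀ (by positivity)] at h
  refine h.trans ?_
  rw [← mul_assoc]
  refine mul_le_mul_of_nonneg_right ?_ (by positivity)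
  rw [Real.sqrt_mul (by norm_num), ← mul_assoc, div_mul_cancel₀ _ (by positivity)]
  gcongr
  rw [Real.sqrt_le_left (by positivity)]
  push_cast
  nlinarith [(Nat.cast_nonneg n : (0 : ℝ) ≤ n)]

theorem pow_div_exp_le_factorial (n : ℕ) :
    ((n : ℝ) / Real.exp 1) ^ n ≤ n.factorial := by
  have h := Real.pow_div_factorial_le_exp (x := n) (by positivity) n
  rw [div_le_iff₀ (by positivity)] at h
  rw [div_pow, div_le_iff₀ (by positivity), ← Real.exp_nat_mul, mul_one]
  linarith

/-- Up to a polynomial factor, the upper bound for the number of words of a type is sharp. -/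
theorem le_logb_card_typeClass (n : V → ℕ) (hn : ∑ a, n a = Fintype.card ι)
    (hι : 0 < Fintype.card ι) :
    (Fintype.card ι * entropyTwo fun a => (n a : ℝ) / Fintype.card ι) -
      Fintype.card V * Real.logb 2 (Real.exp 1 * (Fintype.card ι + 1)) ≤
      Real.logb 2 #(typeClass ι n) := by
  set t := Fintype.card ι
  have hc : (0 : ℝ) < #(typeClass ι n) := by exact_mod_cast card_typeClass_pos n hn
  have hp := prod_pow_type_pos n hι
  have ht : (0 : ℝ) < t := by exact_mod_cast hι
  have he : (0 : ℝ) < Real.exp 1 := Real.exp_pos 1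
  have hle : ∀ a, n a ≤ t := fun a => by
    rw [← hn]; exact Finset.single_le_sum (fun _ _ => Nat.zero_le _) (mem_univ a)
  -- Stirling's bounds for `t! / ∏ a, (n a)!`, in which the powers of `e` cancel.
  have key : (1 : ℝ) ≤ #(typeClass ι n) *
      ((∏ a, ((n a : ℝ) / t) ^ n a) * (Real.exp 1 * (t + 1)) ^ Fintype.card V) := by
    have h1 : (#(typeClass ι n) : ℝ) * ∏ a, ((n a).factorial : ℝ) = t.factorial := by
      exact_mod_cast card_typeClass_mul (ι := ι) hn
    have h2 : ∏ a, ((n a).factorial : ℝ) ≤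
        ((∏ a, ((n a : ℝ) / t) ^ n a) * (Real.exp 1 * (t + 1)) ^ Fintype.card V) *
          ((t : ℝ) / Real.exp 1) ^ t := by
      calc ∏ a, ((n a).factorial : ℝ)
          ≤ ∏ a, ((((n a : ℝ) / t) ^ n a * (Real.exp 1 * (t + 1))) *
              ((t : ℝ) / Real.exp 1) ^ n a) := by
            refine Finset.prod_le_prod (fun _ _ => by positivity) fun a _ => ?_
            refine (factorial_le_exp_mul (n a)).trans ?_
            have h3 : ((n a : ℝ) / t) ^ n a * (Real.exp 1 * (t + 1)) *
                ((t : ℝ) / Real.exp 1) ^ n a =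
                Real.exp 1 * (t + 1) * ((n a : ℝ) / Real.exp 1) ^ n a := by
              rw [mul_right_comm, ← mul_pow, div_mul_div_cancel₀ ht.ne', mul_comm]
            rw [h3]
            have := hle a
            gcongr
        _ = _ := by
            rw [Finset.prod_mul_distrib, Finset.prod_mul_distrib, Finset.prod_pow_eq_pow_sum, hn]
            simp
    have h4 := pow_div_exp_le_factorial t
    have h5 : (0 : ℝ) < ((t : ℝ) / Real.exp 1) ^ t := by positivity
    refine le_of_mul_le_mul_right ?_ h5
    rw [one_mul]
    refine h4.trans ?_
    rw [← h1, mul_assoc]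
    gcongr
  have h6 := Real.logb_nonneg (b := 2) (by norm_num) key
  rw [Real.logb_mul hc.ne' (by positivity), Real.logb_mul hp.ne' (by positivity),
    logb_prod_pow_type n hι, Real.logb_pow] at h6
  linarith

end Entropy

/-! ### Greedy covers -/

section Codes

/-- If every point of `X` lies in at least `d` members of the family `B`, then choosing the members
of the family greedily multiplies the number of uncovered points by at most `1 - d / #Γ` in each
step. -/
theorem exists_greedy_cover {α Γ : Type*} [DecidableEq α] [Fintype Γ] [Nonempty Γ] [DecidableEq Γ]
    (X : Finset α) (B : Γ → Finset α) (d : ℕ) (h : ∀ x ∈ X, d ≤ #{g | x ∈ B g}) (k : ℕ) :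
    ∃ S : Finset Γ, #S ≤ k ∧
      (#(X \ S.biUnion B) : ℝ) ≤ #X * (1 - (d : ℝ) / Fintype.card Γ) ^ k := by
  have hΓ : (0 : ℝ) < Fintype.card Γ := by exact_mod_cast Fintype.card_pos
  induction k with
  | zero => exact ⟨∅, by simp⟩
  | succ k ih =>
    obtain ⟨S, hS, hc⟩ := ih
    set W := X \ S.biUnion B with hW
    have hsum : d * #W ≤ ∑ g, #(W ∩ B g) := by
      have : ∑ g, #(W ∩ B g) = ∑ w ∈ W, #{g | w ∈ B g} := by
        simp only [← Finset.filter_mem_eq_inter]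
        exact Finset.sum_card_bipartiteAbove_eq_sum_card_bipartiteBelow (fun g w => w ∈ B g)
      rw [this, mul_comm]
      exact Finset.card_nsmul_le_sum _ _ _ fun w hw => h w (Finset.mem_sdiff.1 hw).1
    obtain ⟨g, -, hg⟩ : ∃ g ∈ (univ : Finset Γ),
        (d : ℝ) / Fintype.card Γ * #W ≤ (#(W ∩ B g) : ℝ) := by
      refine Finset.exists_le_of_sum_le univ_nonempty ?_
      rw [Finset.sum_const, Finset.card_univ, nsmul_eq_mul, ← mul_assoc,
        mul_div_cancel₀ _ hΓ.ne']
      exact_mod_cast hsum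
    have hd : (d : ℝ) / Fintype.card Γ ≤ 1 ∨ #W = 0 := by
      rcases Nat.eq_zero_or_pos #W with h0 | h0
      · exact Or.inr h0
      · left
        obtain ⟨w, hw⟩ := Finset.card_pos.1 h0
        rw [div_le_one hΓ]
        exact_mod_cast (h w (Finset.mem_sdiff.1 hw).1).trans (Finset.card_le_univ _)
    refine ⟨insert g S, (Finset.card_insert_le _ _).trans (by omega), ?_⟩
    have h1 : X \ (insert g S).biUnion B = W \ B g := by
      rw [Finset.biUnion_insert, Finset.union_comm, hW, sdiff_sdiff_left]
      rfl
    have h2 : (#(W \ B g) : ℝ) = #W - #(W ∩ B g) := by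
      rw [eq_sub_iff_add_eq]
      exact_mod_cast Finset.card_sdiff_add_card_inter W (B g)
    rw [h1, h2, pow_succ, ← mul_assoc]
    rcases hd with hd | hd
    · calc (#W : ℝ) - #(W ∩ B g) ≤ #W * (1 - (d : ℝ) / Fintype.card Γ) := by linarith
        _ ≤ _ := mul_le_mul_of_nonneg_right hc (by linarith)
    · have h3 : #(W ∩ B g) = 0 := by
        rw [Finset.card_eq_zero] at hd ⊢
        simp [hd]
      rw [hd, h3]
      by_cases hX : #X = 0
      · simp [hX]
      · have h4 : (d : ℝ) / Fintype.card Γ ≤ 1 := by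
          obtain ⟨w, hw⟩ := Finset.card_pos.1 (Nat.pos_of_ne_zero hX)
          rw [div_le_one hΓ]
          exact_mod_cast (h w hw).trans (Finset.card_le_univ _)
        have : 0 ≤ 1 - (d : ℝ) / Fintype.card Γ := by linarith
        simp only [Nat.cast_zero, sub_zero]
        positivity

/-- A greedy cover by a family in which every point of `X` has multiplicity at least `d`. -/
theorem exists_small_cover {α Γ : Type*} [DecidableEq α] [Fintype Γ] [Nonempty Γ] [DecidableEq Γ]
    (X : Finset α) (B : Γ → Finset α) (d : ℕ) (hd : 0 < d) (h : ∀ x ∈ X, d ≤ #{g | x ∈ B g}) :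
    ∃ S : Finset Γ, (#S : ℝ) ≤ (Fintype.card Γ : ℝ) / d * Real.log #X + 1 ∧
      X ⊆ S.biUnion B := by
  have hΓ : (0 : ℝ) < Fintype.card Γ := by exact_mod_cast Fintype.card_pos
  have hd' : (0 : ℝ) < d := by exact_mod_cast hd
  rcases X.eq_empty_or_nonempty with rfl | hX
  · exact ⟨∅, by simp⟩
  have hX' : (1 : ℝ) ≤ #X := by exact_mod_cast hX.card_pos
  set r : ℝ := (Fintype.card Γ : ℝ) / d * Real.log #X
  have hr : 0 ≤ r := mul_nonneg (by positivity) (Real.log_nonneg hX')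
  obtain ⟨S, hS, hc⟩ := exists_greedy_cover X B d h (⌊r⌋₊ + 1)
  refine ⟨S, ?_, ?_⟩
  · calc (#S : ℝ) ≤ (⌊r⌋₊ + 1 : ℕ) := by exact_mod_cast hS
      _ ≤ r + 1 := by push_cast; linarith [Nat.floor_le hr]
  · have h1 : (#(X \ S.biUnion B) : ℝ) < 1 := by
      set q : ℝ := (d : ℝ) / Fintype.card Γ
      have hq : q ≤ 1 := by
        obtain ⟨w, hw⟩ := hX
        rw [div_le_one hΓ]
        exact_mod_cast (h w hw).trans (Finset.card_le_univ _)
      have hq0 : 0 < q := by positivity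
      have h2 : (1 - q) ^ (⌊r⌋₊ + 1) ≤ Real.exp (-q) ^ (⌊r⌋₊ + 1) :=
        pow_le_pow_left₀ (by linarith) (by linarith [Real.add_one_le_exp (-q)]) _
      rw [← Real.exp_nat_mul] at h2
      have h3 : Real.log #X < q * (⌊r⌋₊ + 1 : ℕ) := by
        have h4 := Nat.lt_floor_add_one r
        have h5 : Real.log #X = q * r := by
          simp only [q, r]
          field_simp
        rw [h5]
        push_cast
        exact mul_lt_mul_of_pos_left h4 hq0
      calc (#(X \ S.biUnion B) : ℝ) ≤ #X * (1 - q) ^ (⌊r⌋₊ + 1) := hc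
        _ ≤ #X * Real.exp ((⌊r⌋₊ + 1 : ℕ) * -q) := by gcongr
        _ < #X * Real.exp (-Real.log #X) := by
            refine mul_lt_mul_of_pos_left (Real.exp_lt_exp.2 ?_) (by linarith)
            linarith
        _ = 1 := by rw [Real.exp_neg, Real.exp_log (by linarith), mul_inv_cancel₀ (by linarith)]
    have h6 : #(X \ S.biUnion B) = 0 := by
      have : #(X \ S.biUnion B) < 1 := by exact_mod_cast h1
      omega
    exact Finset.sdiff_eq_empty_iff_subset.1 (Finset.card_eq_zero.1 h6)

/-! ### Codes in type classes -/

/-- A set of words is a code if it is independent in the AND power of `G`: no two different words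
`x`, `y` in it satisfy, in every coordinate, `x i = y i` or `G.Adj (x i) (y i)`. -/
def IsCode {ι V : Type*} (G : Digraph V) (A : Finset (ι → V)) : Prop :=
  ∀ x ∈ A, ∀ y ∈ A, (∀ i, x i = y i ∨ G.Adj (x i) (y i)) → x = y

variable {ι κ V : Type*} {G : Digraph V}

/-- Permuting the positions preserves codes. -/
theorem IsCode.image_comp_equiv [Fintype κ] [DecidableEq V] {A : Finset (ι → V)}
    (hA : IsCode G A) (e : κ ≃ ι) :
    IsCode G (A.image (· ∘ e)) := by
  intro x hx y hy h
  obtain ⟨x', hx', rfl⟩ := Finset.mem_image.1 hx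
  obtain ⟨y', hy', rfl⟩ := Finset.mem_image.1 hy
  rw [hA x' hx' y' hy' fun i => by simpa using h (e.symm i)]

variable [Fintype ι] [DecidableEq ι] [DecidableEq V]

/-- Since the permutations of the positions act transitively on a type class, the class is covered
by few permuted copies of any code in it. -/
theorem exists_cover_typeClass [Fintype V] {n : V → ℕ} {A : Finset (ι → V)}
    (hA : IsCode G A) (hAn : A ⊆ typeClass ι n) (hne : A.Nonempty) :
    ∃ C : Finset (Finset (ι → V)), (∀ B ∈ C, IsCode G B) ∧
      (∀ x ∈ typeClass ι n, ∃ B ∈ C, x ∈ B) ∧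
      (#C : ℝ) ≤ (#(typeClass ι n) : ℝ) / #A * Real.log #(typeClass ι n) + 1 := by
  obtain ⟨a₀, ha₀⟩ := hne
  have hn : ∑ a, n a = Fintype.card ι := by
    rw [← mem_typeClass.1 (hAn ha₀)]; exact sum_wordType a₀
  set N := ∏ a, (n a).factorial
  have hN : 0 < N := Finset.prod_pos fun a _ => Nat.factorial_pos _
  have hA0 : 0 < #A := Finset.card_pos.2 ⟨a₀, ha₀⟩
  -- Each word lies in `#A * N` of the `(#ι)!` permuted copies of `A`.
  have hmult : ∀ x ∈ typeClass ι n,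
      #A * N ≤ #{g : Equiv.Perm ι | x ∈ A.image (· ∘ g)} := by
    intro x hx
    have h1 : ({g : Equiv.Perm ι | x ∈ A.image (· ∘ g)} : Finset _) =
        A.biUnion fun a => {g : Equiv.Perm ι | a ∘ g = x} := by
      ext g; simp
    rw [h1, Finset.card_biUnion]
    · rw [Finset.sum_congr rfl fun a ha => card_perm_comp_eq
        ((mem_typeClass.1 (hAn ha)).trans (mem_typeClass.1 hx).symm),
        Finset.sum_congr rfl fun a ha => by rw [mem_typeClass.1 (hAn ha)]]
      simp [N]
    · intro a _ b _ hab
      refine Finset.disjoint_left.2 ?_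
      intro g hg hg'
      simp only [Finset.mem_filter, Finset.mem_univ, true_and] at hg hg'
      exact hab (g.surjective.injective_comp_right (hg.trans hg'.symm))
  obtain ⟨S, hS, hcov⟩ := exists_small_cover (typeClass ι n)
    (fun g : Equiv.Perm ι => A.image (· ∘ g)) (#A * N) (by positivity) hmult
  refine ⟨S.image fun g : Equiv.Perm ι => A.image (· ∘ g), ?_, ?_, ?_⟩
  · intro B hB
    obtain ⟨g, -, rfl⟩ := Finset.mem_image.1 hB
    exact hA.image_comp_equiv g
  · intro x hx
    obtain ⟨g, hg, hxg⟩ := Finset.mem_biUnion.1 (hcov hx)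
    exact ⟨_, Finset.mem_image_of_mem _ hg, hxg⟩
  · refine (Nat.cast_le.2 Finset.card_image_le).trans (hS.trans (le_of_eq ?_))
    rw [Fintype.card_perm, ← card_typeClass_mul (ι := ι) hn]
    have hN' : (N : ℝ) ≠ 0 := by positivity
    rw [Nat.cast_mul, Nat.cast_mul, mul_div_mul_right _ _ hN']

variable [Fintype V]

open Classical in
/-- The largest size of a code in a type class. -/
noncomputable def codeNum (G : Digraph V) (n : V → ℕ) : ℕ :=
  ((typeClass (Fin (∑ a, n a)) n).powerset.filter (IsCode G)).sup card

theorem card_le_codeNum {n : V → ℕ} {A : Finset (ι → V)} (hA : IsCode G A)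
    (hAn : A ⊆ typeClass ι n) : #A ≤ codeNum G n := by
  rcases A.eq_empty_or_nonempty with rfl | ⟨a₀, ha₀⟩
  · simp
  have hn : ∑ a, n a = Fintype.card ι := by
    rw [← mem_typeClass.1 (hAn ha₀)]; exact sum_wordType a₀
  have e : Fin (∑ a, n a) ≃ ι := Fintype.equivOfCardEq (by simp [hn])
  rw [← Finset.card_image_of_injective A (f := (· ∘ e)) e.surjective.injective_comp_right]
  classical
  refine le_trans ?_ (Finset.le_sup (f := card) (b := A.image (· ∘ e)) ?_)
  · rfl
  rw [Finset.mem_filter, Finset.mem_powerset]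
  refine ⟨fun x hx => ?_, hA.image_comp_equiv e⟩
  obtain ⟨y, hy, rfl⟩ := Finset.mem_image.1 hx
  rw [mem_typeClass, wordType_comp_equiv, mem_typeClass.1 (hAn hy)]

theorem exists_code_card_eq_codeNum (G : Digraph V) {n : V → ℕ}
    (hn : ∑ a, n a = Fintype.card ι) :
    ∃ A : Finset (ι → V), IsCode G A ∧ A ⊆ typeClass ι n ∧ #A = codeNum G n := by
  classical
  obtain ⟨A, hA, hc⟩ := Finset.exists_mem_eq_sup
    ((typeClass (Fin (∑ a, n a)) n).powerset.filter (IsCode G))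
    ⟨∅, by simp [IsCode]⟩ card
  rw [Finset.mem_filter, Finset.mem_powerset] at hA
  have e : ι ≃ Fin (∑ a, n a) := Fintype.equivOfCardEq (by simp [hn])
  refine ⟨A.image (· ∘ e), hA.2.image_comp_equiv e, fun x hx => ?_, ?_⟩
  · obtain ⟨y, hy, rfl⟩ := Finset.mem_image.1 hx
    rw [mem_typeClass, wordType_comp_equiv, mem_typeClass.1 (hA.1 hy)]
  · rw [Finset.card_image_of_injective A e.surjective.injective_comp_right, codeNum]
    convert hc.symm

theorem codeNum_pos (G : Digraph V) (n : V → ℕ) : 0 < codeNum G n := by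
  obtain ⟨x, hx⟩ := exists_wordType_eq (ι := Fin (∑ a, n a)) (n := n) (by simp)
  refine Nat.lt_of_lt_of_le ?_ (card_le_codeNum (G := G) (A := {x}) ?_ ?_)
  · simp
  · simp [IsCode]
  · simpa [mem_typeClass] using hx

/-- Concatenating the words of two codes gives a code. -/
theorem codeNum_mul_le (G : Digraph V) (n m : V → ℕ) :
    codeNum G n * codeNum G m ≤ codeNum G (n + m) := by
  obtain ⟨A, hA, hAn, hAc⟩ :=
    exists_code_card_eq_codeNum G (ι := Fin (∑ a, n a)) (n := n) (by simp)
  obtain ⟨B, hB, hBm, hBc⟩ :=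
    exists_code_card_eq_codeNum G (ι := Fin (∑ a, m a)) (n := m) (by simp)
  have hinj : Function.Injective fun p : (Fin (∑ a, n a) → V) × (Fin (∑ a, m a) → V) =>
      Sum.elim p.1 p.2 := by
    intro p q h
    exact Prod.ext (funext fun i => congrFun h (Sum.inl i)) (funext fun i => congrFun h (Sum.inr i))
  rw [← hAc, ← hBc, ← Finset.card_product, ← Finset.card_image_of_injective _ hinj]
  refine card_le_codeNum ?_ ?_
  · intro x hx y hy h
    obtain ⟨p, hp, rfl⟩ := Finset.mem_image.1 hx
    obtain ⟨q, hq, rfl⟩ := Finset.mem_image.1 hy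
    rw [Finset.mem_product] at hp hq
    rw [hA _ hp.1 _ hq.1 fun i => h (Sum.inl i), hB _ hp.2 _ hq.2 fun i => h (Sum.inr i)]
  · intro x hx
    obtain ⟨p, hp, rfl⟩ := Finset.mem_image.1 hx
    rw [Finset.mem_product] at hp
    rw [mem_typeClass, wordType_sumElim, mem_typeClass.1 (hAn hp.1), mem_typeClass.1 (hBm hp.2)]

/-- Repeating a code of type `n` and filling up with a fixed word gives a code of any type that
dominates a multiple of `n`. -/
theorem codeNum_pow_le (G : Digraph V) {n m : V → ℕ} {k : ℕ} (h : ∀ a, k * n a ≤ m a) :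
    codeNum G n ^ k ≤ codeNum G m := by
  have h1 : codeNum G n ^ k ≤ codeNum G (k • n) := by
    clear h
    induction k with
    | zero => simpa using Nat.succ_le_of_lt (codeNum_pos G 0)
    | succ k ih =>
      rw [pow_succ, succ_nsmul]
      exact (Nat.mul_le_mul_right _ ih).trans (codeNum_mul_le G _ _)
  have h2 : k • n + (m - k • n) = m := by
    funext a
    simpa using Nat.add_sub_cancel' (h a)
  calc codeNum G n ^ k ≤ codeNum G (k • n) * 1 := by simpa using h1
    _ ≤ codeNum G (k • n) * codeNum G (m - k • n) := Nat.mul_le_mul_left _ (codeNum_pos G _)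
    _ ≤ codeNum G m := by simpa only [h2] using codeNum_mul_le G (k • n) (m - k • n)

/-- The type of the image of a word of type `n` under a map of letters. -/
def pushType (f : V → V) (n : V → ℕ) (c : V) : ℕ := ∑ a with f a = c, n a

omit [DecidableEq ι] in
theorem wordType_comp (f : V → V) (x : ι → V) :
    wordType (f ∘ x) = pushType f (wordType x) := by
  funext c
  rw [pushType, wordType,
    Finset.card_eq_sum_card_fiberwise (f := x) (t := ({a | f a = c} : Finset V))]
  · refine Finset.sum_congr rfl fun a ha => ?_
    rw [wordType, Finset.filter_filter]
    congr 1
    ext i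
    simp only [Finset.mem_filter, Finset.mem_univ, true_and, Function.comp_apply] at ha ⊢
    constructor
    · exact fun h => h.2
    · rintro rfl; exact ⟨ha, rfl⟩
  · intro i hi
    simpa using hi

theorem sum_pushType (f : V → V) (n : V → ℕ) : ∑ c, pushType f n c = ∑ a, n a :=
  Finset.sum_fiberwise univ f n

/-- Letters outside a set `S` can be replaced by a fixed letter of `S` at the cost of fixing their
pattern, that is, the word obtained by replacing the letters in `S` instead. Two words with the
same pattern differ only at positions that carry letters of `S`. -/
theorem codeNum_le_mul_codeNum (G : Digraph V) (S : Finset V) {a₀ : V} (ha₀ : a₀ ∈ S)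
    {n : V → ℕ} (hn : ∑ a, n a = Fintype.card ι) :
    codeNum G n ≤ codeNum G (pushType (fun a => if a ∈ S then a else a₀) n) *
      #(typeClass ι (pushType (fun a => if a ∈ S then a₀ else a) n)) := by
  obtain ⟨A, hA, hAn, hAc⟩ := exists_code_card_eq_codeNum G hn
  rw [← hAc]
  set f : V → V := fun a => if a ∈ S then a₀ else a with hf
  set g : V → V := fun a => if a ∈ S then a else a₀ with hg
  have hfg : ∀ a b, f a = f b → g a = g b → a = b := by
    intro a b h1 h2
    simp only [hf, hg] at h1 h2
    split_ifs at h1 h2 <;> simp_all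
  have hadj : ∀ a b, f a = f b → (g a = g b ∨ G.Adj (g a) (g b)) → (a = b ∨ G.Adj a b) := by
    intro a b h1 h2
    rcases h2 with h2 | h2
    · exact Or.inl (hfg a b h1 h2)
    · simp only [hf, hg] at h1 h2
      split_ifs at h1 h2 <;> simp_all
  refine Finset.card_le_mul_card_image_of_maps_to (f := fun x => f ∘ x) (fun x hx => ?_) _
    fun y _ => ?_
  · rw [mem_typeClass, wordType_comp, mem_typeClass.1 (hAn hx)]
  · have hinj : Set.InjOn (fun x : ι → V => g ∘ x) (A.filter fun x => f ∘ x = y) := by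
      intro x hx x' hx' h
      simp only [Finset.coe_filter, Set.mem_ofPred_eq] at hx hx'
      exact funext fun i => hfg _ _ (congrFun (hx.2.trans hx'.2.symm) i) (congrFun h i)
    rw [← Finset.card_image_of_injOn hinj]
    refine card_le_codeNum ?_ ?_
    · intro z hz z' hz' h
      obtain ⟨x, hx, rfl⟩ := Finset.mem_image.1 hz
      obtain ⟨x', hx', rfl⟩ := Finset.mem_image.1 hz'
      rw [Finset.mem_filter] at hx hx'
      rw [hA x hx.1 x' hx'.1 fun i => hadj _ _ (congrFun (hx.2.trans hx'.2.symm) i) (h i)]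
    · intro z hz
      obtain ⟨x, hx, rfl⟩ := Finset.mem_image.1 hz
      rw [Finset.mem_filter] at hx
      rw [mem_typeClass, wordType_comp, mem_typeClass.1 (hAn hx.1)]

end Codes

/-! ### Chromatic and independence numbers of sets of words -/

section Parameters

variable {V : Type*} {G : Digraph V} {t : ℕ}

/-- The underlying undirected graph of the AND power induced on a set of words. -/
abbrev powGraph (G : Digraph V) {t : ℕ} (U : Set (Fin t → V)) : SimpleGraph U :=
  ((G.andPow t).inducedOn U).toSimpleGraphInclusive

theorem powGraph_adj {U : Set (Fin t → V)} {x y : U} :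
    (G.powGraph U).Adj x y ↔ x.1 ≠ y.1 ∧
      ((∀ i, x.1 i = y.1 i ∨ G.Adj (x.1 i) (y.1 i)) ∨
        ∀ i, y.1 i = x.1 i ∨ G.Adj (y.1 i) (x.1 i)) := by
  rw [powGraph, toSimpleGraphInclusive.eq_def, SimpleGraph.fromRel_adj, ← Subtype.coe_ne_coe]
  constructor
  · rintro ⟨h, h1 | h1⟩
    · exact ⟨h, Or.inl h1.2⟩
    · exact ⟨h, Or.inr h1.2⟩
  · rintro ⟨h, h1 | h1⟩
    · exact ⟨h, Or.inl ⟨h, h1⟩⟩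
    · exact ⟨h, Or.inr ⟨h.symm, h1⟩⟩

theorem IsCode.not_adj {U : Set (Fin t → V)} {A : Finset (Fin t → V)} (hA : IsCode G A) {x y : U}
    (hx : x.1 ∈ A) (hy : y.1 ∈ A) : ¬ (G.powGraph U).Adj x y := by
  rw [powGraph_adj]
  rintro ⟨h, h1 | h1⟩
  · exact h (hA _ hx _ hy h1)
  · exact h (hA _ hy _ hx h1).symm

theorem chromNum_le_of_colorable {U : Set (Fin t → V)} {k : ℕ} (h : (G.powGraph U).Colorable k) :
    chromNum ((G.andPow t).inducedOn U) ≤ k :=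
  ENat.toNat_le_of_le_natCast h.chromaticNumber_le

theorem IsCode.card_le_indepNum [Finite V] {U : Set (Fin t → V)} {A : Finset (Fin t → V)}
    (hA : IsCode G A) (hU : ∀ x ∈ A, x ∈ U) : #A ≤ indepNum ((G.andPow t).inducedOn U) := by
  classical
  have h1 : #(A.subtype (· ∈ U)) = #A := by
    rw [Finset.card_subtype, Finset.filter_true_of_mem hU]
  rw [← h1]
  refine SimpleGraph.IsIndepSet.card_le_indepNum ?_
  intro x hx y hy _
  exact hA.not_adj (by simpa using hx) (by simpa using hy)

theorem exists_code_card_eq_indepNum (G : Digraph V) (U : Set (Fin t → V)) :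
    ∃ A : Finset (Fin t → V), IsCode G A ∧ (∀ x ∈ A, x ∈ U) ∧
      #A = indepNum ((G.andPow t).inducedOn U) := by
  classical
  obtain ⟨s, hs⟩ := (G.powGraph U).exists_isNIndepSet_indepNum
  refine ⟨s.map (Function.Embedding.subtype _), ?_, ?_, by rw [Finset.card_map]; exact hs.card_eq⟩
  · intro x hx y hy h
    obtain ⟨x', hx', rfl⟩ := Finset.mem_map.1 hx
    obtain ⟨y', hy', rfl⟩ := Finset.mem_map.1 hy
    by_contra hne
    exact hs.isIndepSet hx' hy' (fun h' => hne (by rw [h']))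
      (powGraph_adj.2 ⟨hne, Or.inl h⟩)
  · intro x hx
    obtain ⟨x', hx', rfl⟩ := Finset.mem_map.1 hx
    exact x'.2

theorem indepNum_mono [Finite V] {U U' : Set (Fin t → V)} (h : U ⊆ U') :
    indepNum ((G.andPow t).inducedOn U) ≤ indepNum ((G.andPow t).inducedOn U') := by
  obtain ⟨A, hA, hAU, hc⟩ := exists_code_card_eq_indepNum G U
  rw [← hc]
  exact hA.card_le_indepNum fun x hx => h (hAU x hx)

theorem chromNum_mono [Finite V] {U U' : Set (Fin t → V)} (h : U ⊆ U') :
    chromNum ((G.andPow t).inducedOn U) ≤ chromNum ((G.andPow t).inducedOn U') := by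
  refine chromNum_le_of_colorable ?_
  obtain ⟨c⟩ := (G.powGraph U').colorable_chromaticNumber_of_fintype
  exact ⟨SimpleGraph.Coloring.mk (fun x => c ⟨x.1, h x.2⟩) fun {x y} hxy =>
    c.valid (v := ⟨x.1, h x.2⟩) (w := ⟨y.1, h y.2⟩) (powGraph_adj.2 (powGraph_adj.1 hxy :))⟩

/-- A cover by codes can be turned into a proper coloring. -/
theorem chromNum_le_of_cover {U : Set (Fin t → V)} (C : Finset (Finset (Fin t → V)))
    (hC : ∀ B ∈ C, IsCode G B) (hU : ∀ x ∈ U, ∃ B ∈ C, x ∈ B) :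
    chromNum ((G.andPow t).inducedOn U) ≤ #C := by
  refine chromNum_le_of_colorable ?_
  choose f hf using fun x : U => hU x.1 x.2
  have c : (G.powGraph U).Coloring C := SimpleGraph.Coloring.mk (fun x => ⟨f x, (hf x).1⟩) <| by
    intro x y hxy h
    have h' : f x = f y := congrArg Subtype.val h
    exact (hC _ (hf x).1).not_adj (hf x).2 (h' ▸ (hf y).2) hxy
  simpa using c.colorable

theorem card_le_chromNum_mul_indepNum [Finite V] (G : Digraph V) (U : Set (Fin t → V))
    {X : Finset (Fin t → V)} (hX : ∀ x ∈ X, x ∈ U) :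
    #X ≤ chromNum ((G.andPow t).inducedOn U) * indepNum ((G.andPow t).inducedOn U) := by
  classical
  obtain ⟨c⟩ := (G.powGraph U).colorable_chromaticNumber_of_fintype
  have h1 : #X = #(X.subtype (· ∈ U)) := by
    rw [Finset.card_subtype, Finset.filter_true_of_mem hX]
  rw [h1, mul_comm]
  refine (Finset.card_le_mul_card_image_of_maps_to (f := c) (t := univ)
    (fun _ _ => mem_univ _) (indepNum ((G.andPow t).inducedOn U)) fun b _ => ?_).trans
      (le_of_eq (by simp [chromNum]))
  refine SimpleGraph.IsIndepSet.card_le_indepNum ?_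
  intro x hx y hy _ hxy
  simp only [Finset.coe_filter, Set.mem_ofPred_eq] at hx hy
  exact c.valid hxy (hx.2.trans hy.2.symm)

end Parameters

/-! ### Logarithms and exponents -/

section Logarithms

theorem logb_natCast_nonneg (k : ℕ) : 0 ≤ Real.logb 2 k := by
  rcases Nat.eq_zero_or_pos k with rfl | h
  · simp
  · exact Real.logb_nonneg (by norm_num) (by exact_mod_cast h)

theorem logb_natCast_mono {k l : ℕ} (h : k ≤ l) : Real.logb 2 k ≤ Real.logb 2 l := by
  rcases Nat.eq_zero_or_pos k with rfl | hk
  · simpa using logb_natCast_nonneg l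
  · exact Real.logb_le_logb_of_le (by norm_num) (by exact_mod_cast hk) (by exact_mod_cast h)

/-- Factors that are polynomial in `t` do not contribute to exponents. -/
theorem tendsto_add_mul_logb_div (a b : ℝ) :
    Tendsto (fun t : ℕ => (a + b * Real.logb 2 (t + 1)) / t) atTop (𝓝 0) := by
  have h1 : Tendsto (fun t : ℕ => Real.log ((t : ℝ) + 1) / ((t : ℝ) + 1)) atTop (𝓝 0) := by
    have := Real.isLittleO_log_id_atTop.tendsto_div_nhds_zero
    have h2 : Tendsto (fun t : ℕ => (t : ℝ) + 1) atTop atTop :=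
      tendsto_atTop_add_const_right _ _ tendsto_natCast_atTop_atTop
    exact this.comp h2
  have h3 : Tendsto (fun t : ℕ => 1 / (t : ℝ)) atTop (𝓝 0) := tendsto_one_div_atTop_nhds_zero_nat
  have h4 : Tendsto (fun t : ℕ => a * (1 / (t : ℝ)) + b / Real.log 2 *
      (Real.log ((t : ℝ) + 1) / ((t : ℝ) + 1) * (1 + 1 / (t : ℝ)))) atTop
      (𝓝 (a * 0 + b / Real.log 2 * (0 * (1 + 0)))) :=
    (h3.const_mul a).add ((h1.mul (h3.const_add 1)).const_mul _)
  simp only [mul_zero, zero_mul, add_zero] at h4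
  refine h4.congr' ?_
  filter_upwards [eventually_gt_atTop 0] with t ht
  have : (t : ℝ) ≠ 0 := by positivity
  have : (t : ℝ) + 1 ≠ 0 := by positivity
  rw [Real.logb]
  field_simp

end Logarithms

section Exponents

variable {V : Type*} [DecidableEq V]

theorem typicalSet_mono (P : V → ℝ) {ε ε' : ℝ} (h : ε ≤ ε') (t : ℕ) :
    typicalSet P ε t ⊆ typicalSet P ε' t :=
  fun _ hx a => (hx a).trans_le h

theorem mem_typicalSet {P : V → ℝ} {ε : ℝ} {t : ℕ} {x : Fin t → V} :
    x ∈ typicalSet P ε t ↔ ∀ a, |(wordType x a : ℝ) / t - P a| < ε :=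
  Iff.rfl

theorem monotone_typicalExponent_chromNum [Finite V] (G : Digraph V) (P : V → ℝ) :
    Monotone (typicalExponent chromNum G P) := fun ε ε' h =>
  limsup_le_limsup <| Eventually.of_forall fun t => EReal.coe_le_coe <|
    div_le_div_of_nonneg_right (logb_natCast_mono (chromNum_mono (typicalSet_mono P h t)))
      (Nat.cast_nonneg t)

theorem monotone_typicalExponent_indepNum [Finite V] (G : Digraph V) (P : V → ℝ) :
    Monotone (typicalExponent indepNum G P) := fun ε ε' h =>
  limsup_le_limsup <| Eventually.of_forall fun t => EReal.coe_le_coe <|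
    div_le_div_of_nonneg_right (logb_natCast_mono (indepNum_mono (typicalSet_mono P h t)))
      (Nat.cast_nonneg t)

theorem chromNum_le_card_pow [Fintype V] (G : Digraph V) {t : ℕ} (U : Set (Fin t → V)) :
    chromNum ((G.andPow t).inducedOn U) ≤ Fintype.card V ^ t := by
  classical
  refine (chromNum_le_of_cover (univ.image fun x : Fin t → V => {x}) ?_ ?_).trans
    (Finset.card_image_le.trans (by simp))
  · simp [IsCode]
  · intro x _
    exact ⟨{x}, by simp, by simp⟩

omit [DecidableEq V] in
theorem indepNum_le_card_pow [Fintype V] (G : Digraph V) {t : ℕ} (U : Set (Fin t → V)) :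
    indepNum ((G.andPow t).inducedOn U) ≤ Fintype.card V ^ t := by
  obtain ⟨A, -, -, hc⟩ := exists_code_card_eq_indepNum G U
  rw [← hc]
  exact (Finset.card_le_univ A).trans (by simp)

/-- The exponent of a sequence of integers bounded by `c ^ t` is finite. -/
theorem limsup_logb_mem_Icc {c : ℕ} {k : ℕ → ℕ} (h : ∀ t, k t ≤ c ^ t) :
    limsup (fun t : ℕ => ((Real.logb 2 (k t) / t : ℝ) : EReal)) atTop ∈
      Set.Icc ((0 : ℝ) : EReal) (Real.logb 2 c : ℝ) := by
  constructor
  · refine le_limsup_of_frequently_le' (Frequently.of_forall fun t => EReal.coe_le_coe ?_)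
    exact div_nonneg (logb_natCast_nonneg _) (Nat.cast_nonneg t)
  · refine limsup_le_of_le (h := ?_)
    filter_upwards [eventually_gt_atTop 0] with t ht
    refine EReal.coe_le_coe ?_
    rw [div_le_iff₀ (by exact_mod_cast ht), mul_comm, ← Real.logb_pow]
    exact_mod_cast logb_natCast_mono (h t)

end Exponents

/-! ### Distributions and types near a given distribution -/

section Types

variable {V : Type*} [Fintype V] [DecidableEq V]

omit [DecidableEq V] in
/-- A property of distributions near `P` holds for all types that are close to `P` letterwise. -/
theorem exists_pos_of_eventually_nhds {P : V → ℝ} {p : (V → ℝ) → Prop} (h : ∀ᶠ Q in 𝓝 P, p Q) :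
    ∃ ε > 0, ∀ Q : V → ℝ, (∀ a, |Q a - P a| < ε) → p Q := by
  obtain ⟨ε, hε, hp⟩ := Metric.eventually_nhds_iff.1 h
  exact ⟨ε, hε, fun Q hQ => hp ((dist_pi_lt_iff hε).2 hQ)⟩

/-- Every distribution is a limit of types. -/
theorem exists_types_tendsto {P : V → ℝ} (hP : ∀ a, 0 ≤ P a) (hPsum : ∑ a, P a = 1) :
    ∃ n : ℕ → V → ℕ, (∀ t, ∑ a, n t a = t) ∧
      Tendsto (fun t a => (n t a : ℝ) / t) atTop (𝓝 P) := by
  obtain ⟨a₀⟩ : Nonempty V := by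
    by_contra h
    rw [not_nonempty_iff] at h
    simp at hPsum
  set f : ℕ → V → ℕ := fun t a => ⌊P a * t⌋₊
  have hf : ∀ a, Tendsto (fun t => (f t a : ℝ) / t) atTop (𝓝 (P a)) := fun a =>
    (tendsto_nat_floor_mul_div_atTop (hP a)).comp tendsto_natCast_atTop_atTop
  have hle : ∀ t, ∑ a ∈ univ.erase a₀, f t a ≤ t := by
    intro t
    have h1 : (∑ a ∈ univ.erase a₀, f t a : ℝ) ≤ ∑ a, P a * t := by
      refine (Finset.sum_le_sum fun a _ => Nat.floor_le (mul_nonneg (hP a) t.cast_nonneg)).trans ?_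
      exact Finset.sum_le_sum_of_subset_of_nonneg (Finset.subset_univ _)
        fun a _ _ => mul_nonneg (hP a) t.cast_nonneg
    rw [← Finset.sum_mul, hPsum, one_mul] at h1
    exact_mod_cast h1
  -- Rounding down leaves a few positions free, which are given to the letter `a₀`.
  refine ⟨fun t a => if a = a₀ then t - ∑ a ∈ univ.erase a₀, f t a else f t a, fun t => ?_, ?_⟩
  · beta_reduce
    rw [← Finset.add_sum_erase _ _ (mem_univ a₀), if_pos rfl,
      Finset.sum_congr rfl fun a ha => if_neg (Finset.ne_of_mem_erase ha)]
    exact Nat.sub_add_cancel (hle t)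
  · rw [tendsto_pi_nhds]
    intro a
    by_cases ha : a = a₀
    · subst ha
      have h2 : P a = 1 - ∑ b ∈ univ.erase a, P b := by
        rw [← hPsum, ← Finset.add_sum_erase _ _ (mem_univ a), add_sub_cancel_right]
      rw [h2]
      refine ((tendsto_finsetSum (univ.erase a) fun b _ => hf b).const_sub 1).congr' ?_
      filter_upwards [eventually_gt_atTop 0] with t ht
      have ht' : (t : ℝ) ≠ 0 := by positivity
      rw [if_pos rfl, Nat.cast_sub (hle t), sub_div, div_self ht', ← Finset.sum_div]
      push_cast
      rfl
    · simpa only [if_neg ha] using hf a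

/-- The image of a distribution under a map of letters. -/
def pushDist (f : V → V) (Q : V → ℝ) (c : V) : ℝ := ∑ a with f a = c, Q a

theorem continuous_pushDist (f : V → V) : Continuous (pushDist f) :=
  continuous_pi fun _ => continuous_finsetSum _ fun a _ => continuous_apply a

theorem pushType_div (f : V → V) (n : V → ℕ) (s : ℝ) (c : V) :
    (pushType f n c : ℝ) / s = pushDist f (fun a => (n a : ℝ) / s) c := by
  simp [pushType, pushDist, Finset.sum_div]

/-- If a map of letters fixes the support of `P`, then it fixes `P`. -/
theorem pushDist_eq_self {f : V → V} {P : V → ℝ} (h : ∀ a, P a ≠ 0 → f a = a) :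
    pushDist f P = P := by
  funext c
  rw [pushDist, Finset.sum_filter, Finset.sum_eq_single c]
  · split_ifs with h1
    · rfl
    · by_contra h2
      exact h1 (h c (Ne.symm h2))
  · intro b _ hb
    split_ifs with h1
    · by_contra h2
      exact hb ((h b h2).symm.trans h1)
    · rfl
  · simp

/-- If a map of letters is constant on the support of `P`, then the image of `P` has entropy
zero. -/
theorem entropyTwo_pushDist_eq_zero {f : V → V} {P : V → ℝ} {a₀ : V} (h : ∀ a, P a ≠ 0 → f a = a₀)
    (hPsum : ∑ a, P a = 1) : entropyTwo (pushDist f P) = 0 := by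
  have h1 : ∀ c, pushDist f P c = if c = a₀ then 1 else 0 := by
    intro c
    rw [pushDist, Finset.sum_filter]
    split_ifs with hc
    · rw [← hPsum]
      refine Finset.sum_congr rfl fun a _ => ?_
      by_cases ha : P a = 0
      · simp [ha]
      · rw [if_pos ((h a ha).trans hc.symm)]
    · refine Finset.sum_eq_zero fun a _ => ?_
      by_cases ha : P a = 0
      · simp [ha]
      · rw [if_neg fun h2 => hc (h2.symm.trans (h a ha))]
  simp only [entropyTwo, h1]
  rw [neg_eq_zero]
  refine Finset.sum_eq_zero fun a _ => ?_
  split_ifs <;> simp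

end Types

/-! ### The two bounds -/

section Rates

variable {V : Type*} [Fintype V] [DecidableEq V]

theorem wordType_mem_piFinset {t : ℕ} (x : Fin t → V) :
    wordType x ∈ Fintype.piFinset fun _ : V => range (t + 1) :=
  Fintype.mem_piFinset.2 fun a => Finset.mem_range.2 <|
    Nat.lt_succ_of_le (by simpa using wordType_le_card x a)

theorem card_piFinset_range (t : ℕ) :
    #(Fintype.piFinset fun _ : V => range (t + 1)) = (t + 1) ^ Fintype.card V := by
  simp

/-- Since there are only polynomially many types, the independence number of a set of typical
words is, up to a polynomial factor, attained within a single type class. -/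
theorem exists_indepNum_le_mul_codeNum (G : Digraph V) (P : V → ℝ) (ε : ℝ) (t : ℕ)
    (h : 0 < indepNum ((G.andPow t).inducedOn (typicalSet P ε t))) :
    ∃ n : V → ℕ, ∑ a, n a = t ∧ (∀ a, |(n a : ℝ) / t - P a| < ε) ∧
      indepNum ((G.andPow t).inducedOn (typicalSet P ε t)) ≤
        codeNum G n * (t + 1) ^ Fintype.card V := by
  obtain ⟨A, hA, hAU, hc⟩ := exists_code_card_eq_indepNum G (typicalSet P ε t)
  rw [← hc] at h ⊢
  obtain ⟨x₀, hx₀, hmax⟩ := Finset.exists_max_image A (fun x => codeNum G (wordType x))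
    (Finset.card_pos.1 h)
  refine ⟨wordType x₀, by simpa using sum_wordType x₀, hAU x₀ hx₀, ?_⟩
  rw [← card_piFinset_range]
  refine (Finset.card_le_mul_card_image (f := wordType) A (codeNum G (wordType x₀)) ?_).trans
    (Nat.mul_le_mul_left _ (Finset.card_le_card ?_))
  · intro n hn
    obtain ⟨y, hy, rfl⟩ := Finset.mem_image.1 hn
    refine (card_le_codeNum (ι := Fin t) (n := wordType y) (G := G) ?_ ?_).trans (hmax y hy)
    · exact fun x hx x' hx' => hA x (Finset.mem_filter.1 hx).1 x' (Finset.mem_filter.1 hx').1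
    · exact fun x hx => mem_typeClass.2 (Finset.mem_filter.1 hx).2
  · intro n hn
    obtain ⟨y, -, rfl⟩ := Finset.mem_image.1 hn
    exact wordType_mem_piFinset y

theorem logb_codeNum_nonneg (G : Digraph V) (n : V → ℕ) : 0 ≤ Real.logb 2 (codeNum G n) :=
  logb_natCast_nonneg _

/-- If the exponents of the independence numbers of typical sets are all at least `γ`, then *every*
type class with a type close to `P` and long enough words contains a code of rate almost `γ`.

For one suitable length `s`, a large code of a single type close to `P` exists. Its letters outside
the support of `P` are replaced, so that its type is dominated by a multiple of `P`; repeating it and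
filling up with a fixed word, one reaches all types close to `P`. -/
theorem exists_le_logb_codeNum (G : Digraph V) {P : V → ℝ} (hP : ∀ a, 0 ≤ P a)
    (hPsum : ∑ a, P a = 1) {γ : ℝ} (hγ : ∀ ε > 0, (γ : EReal) ≤ typicalExponent indepNum G P ε)
    {δ : ℝ} (hδ : 0 < δ) :
    ∃ ε > 0, ∃ T : ℝ, ∀ t : ℕ, T ≤ t → ∀ m : V → ℕ, ∑ a, m a = t →
      (∀ a, |(m a : ℝ) / t - P a| < ε) → t * (γ - δ) ≤ Real.logb 2 (codeNum G m) := by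
  rcases le_or_gt (γ - δ) 0 with h0 | h0
  · exact ⟨1, one_pos, 0, fun t _ m _ _ =>
      (mul_nonpos_of_nonneg_of_nonpos t.cast_nonneg h0).trans (logb_codeNum_nonneg G m)⟩
  obtain ⟨a₀, ha₀⟩ : ∃ a, P a ≠ 0 := by
    by_contra! h
    simp [h] at hPsum
  classical
  set S : Finset V := {a | P a ≠ 0} with hS
  have memS : ∀ a, a ∈ S ↔ P a ≠ 0 := fun a => by simp [hS]
  set f : V → V := fun a => if a ∈ S then a₀ else a
  set g : V → V := fun a => if a ∈ S then a else a₀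
  set η : ℝ := δ / (8 * γ)
  have hγ0 : 0 < γ := by linarith
  have hη : 0 < η := by positivity
  have hηγ : η * γ = δ / 8 := by simp only [η]; field_simp
  have hη1 : η < 1 := by
    simp only [η]
    rw [div_lt_one (by positivity)]
    linarith
  -- Conditions on the type of the short code and on the type to be reached.
  have e1 : ∀ᶠ Q in 𝓝 P, entropyTwo (pushDist f Q) < δ / 8 := by
    refine ((continuous_entropyTwo.comp (continuous_pushDist f)).tendsto P).eventually_lt_const ?_
    have h1 : entropyTwo (pushDist f P) = 0 :=
      entropyTwo_pushDist_eq_zero (fun a ha => if_pos ((memS a).2 ha)) hPsum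
    rw [Function.comp_apply, h1]
    positivity
  have e2 : ∀ᶠ Q in 𝓝 P, ∀ a, pushDist g Q a ≤ (1 + η) * P a := by
    rw [eventually_all]
    intro a
    by_cases ha : P a = 0
    · refine Eventually.of_forall fun Q => ?_
      rw [ha, mul_zero, pushDist]
      refine (Finset.sum_eq_zero fun b hb => ?_).le
      have hb' : g b = a := by simpa using hb
      refine absurd ha ((memS a).1 ?_)
      rw [← hb']
      simp only [g]
      split_ifs with h1
      · exact h1
      · exact (memS a₀).2 ha₀
    · have h1 : Tendsto (fun Q => pushDist g Q a) (𝓝 P) (𝓝 (P a)) := by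
        have h2 := (((continuous_apply a).comp (continuous_pushDist g)).tendsto P)
        have h3 : pushDist g P = P := pushDist_eq_self fun a ha => if_pos ((memS a).2 ha)
        simpa only [Function.comp_def, h3] using h2
      have h4 : 0 < P a := lt_of_le_of_ne (hP a) (Ne.symm ha)
      exact (h1.eventually_lt_const (by nlinarith)).mono fun Q hQ => hQ.le
  have e3 : ∀ᶠ Q in 𝓝 P, ∀ a, P a ≠ 0 → (1 - η) * P a ≤ Q a := by
    rw [eventually_all]
    intro a
    by_cases ha : P a = 0
    · exact Eventually.of_forall fun Q h => absurd ha h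
    · have h4 : 0 < P a := lt_of_le_of_ne (hP a) (Ne.symm ha)
      exact (((continuous_apply a).tendsto P).eventually_const_lt
        (u := (1 - η) * P a) (by nlinarith)).mono fun Q hQ _ => hQ.le
  obtain ⟨ε, hε, hQ⟩ := exists_pos_of_eventually_nhds (e1.and (e2.and e3))
  -- A length `s` at which the exponent is nearly attained and polynomial factors are negligible.
  have hfreq : ∃ᶠ s : ℕ in atTop, γ - δ / 8 <
      Real.logb 2 (indepNum ((G.andPow s).inducedOn (typicalSet P ε s))) / s := by
    have h1 : ((γ - δ / 8 : ℝ) : EReal) < typicalExponent indepNum G P ε :=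
      lt_of_lt_of_le (EReal.coe_lt_coe (by linarith)) (hγ ε hε)
    exact (frequently_lt_of_lt_limsup (h := h1)).mono fun s hs => EReal.coe_lt_coe_iff.1 hs
  obtain ⟨s, hs1, hs2, hs0⟩ := (hfreq.and_eventually
    (((tendsto_add_mul_logb_div 0 (Fintype.card V)).eventually_lt_const
      (show (0 : ℝ) < δ / 8 by positivity)).and (eventually_gt_atTop 0))).exists
  have hs : (0 : ℝ) < s := by exact_mod_cast hs0
  rw [lt_div_iff₀ hs] at hs1
  rw [div_lt_iff₀ hs, zero_add] at hs2
  have hpos : 0 < indepNum ((G.andPow s).inducedOn (typicalSet P ε s)) := by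
    by_contra h
    rw [Nat.eq_zero_of_not_pos h] at hs1
    simp only [Nat.cast_zero, Real.logb_zero] at hs1
    nlinarith
  obtain ⟨n, hn, hnP, hle⟩ := exists_indepNum_le_mul_codeNum G P ε s hpos
  have hlog1 := logb_natCast_mono hle
  have hcn : (0 : ℝ) < codeNum G n := by exact_mod_cast codeNum_pos G n
  rw [Nat.cast_mul, Nat.cast_pow, Real.logb_mul hcn.ne' (by positivity), Real.logb_pow,
    Nat.cast_add_one] at hlog1
  have hlog2 := logb_natCast_mono
    (codeNum_le_mul_codeNum (ι := Fin s) G S ((memS a₀).2 ha₀) (n := n) (by simpa using hn))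
  set n' := pushType g n with hn'
  have hTpos : (0 : ℝ) < #(typeClass (Fin s) (pushType f n)) := by
    exact_mod_cast card_typeClass_pos (ι := Fin s) _ (by simpa [sum_pushType] using hn)
  have hcn' : (0 : ℝ) < codeNum G n' := by exact_mod_cast codeNum_pos G n'
  rw [Nat.cast_mul, Real.logb_mul hcn'.ne' hTpos.ne'] at hlog2
  have hT := logb_card_typeClass_le (ι := Fin s) (pushType f n)
    (by simpa [sum_pushType] using hn) (by simpa using hs0)
  simp only [Fintype.card_fin, pushType_div] at hT
  obtain ⟨hE, hD, -⟩ := hQ _ hnP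
  have hE' := mul_lt_mul_of_pos_left hE hs
  have hcode : s * (γ - δ / 2) ≤ Real.logb 2 (codeNum G n') := by
    have h1 : 0 ≤ s * (δ / 8) := by positivity
    have h2 : Real.logb 2 (codeNum G n) ≤ Real.logb 2 (codeNum G n') + s * (δ / 8) := by
      refine hlog2.trans (add_le_add le_rfl (hT.trans ?_))
      exact hE'.le
    linarith
  have hn'le : ∀ a, (n' a : ℝ) ≤ (1 + η) * P a * s := by
    intro a
    rw [← div_le_iff₀ hs, pushType_div]
    exact hD a
  -- The number of copies is the greatest `k` with `k * (1 + η) * s ≤ (1 - η) * t`.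
  set κ : ℝ := (1 - η) * (γ - δ / 2) - (1 + η) * (γ - δ) with hκ
  have hκ0 : 0 < κ := by
    have : κ = δ / 2 - 2 * (η * γ) + 3 / 2 * (η * δ) := by rw [hκ]; ring
    rw [this, hηγ]
    have := mul_pos hη hδ
    linarith
  refine ⟨ε, hε, max 1 ((1 + η) * s * (γ - δ / 2) / κ), fun t ht m hm hmP => ?_⟩
  have ht1 : (1 : ℝ) ≤ t := (le_max_left _ _).trans ht
  have ht0 : (0 : ℝ) < t := by linarith
  have ht2 : (1 + η) * s * (γ - δ / 2) ≤ t * κ := by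
    rw [← div_le_iff₀ hκ0]
    exact (le_max_right _ _).trans ht
  obtain ⟨-, -, hM⟩ := hQ _ hmP
  set k : ℕ := ⌊(1 - η) * t / ((1 + η) * s)⌋₊
  have hden : 0 < (1 + η) * s := by positivity
  have hk1 : k * ((1 + η) * s) ≤ (1 - η) * t := by
    rw [← le_div_iff₀ hden]
    exact Nat.floor_le (div_nonneg (mul_nonneg (by linarith) ht0.le) hden.le)
  have hk2 : (1 - η) * t < (k + 1) * ((1 + η) * s) := by
    rw [← div_lt_iff₀ hden]
    exact Nat.lt_floor_add_one _
  have hkm : ∀ a, k * n' a ≤ m a := by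
    intro a
    have h1 : (k : ℝ) * n' a ≤ m a := by
      have h2 : (k : ℝ) * n' a ≤ k * ((1 + η) * P a * s) :=
        mul_le_mul_of_nonneg_left (hn'le a) k.cast_nonneg
      by_cases ha : P a = 0
      · rw [ha, mul_zero, zero_mul, mul_zero] at h2
        exact h2.trans (m a).cast_nonneg
      · have h3 := hM a ha
        rw [le_div_iff₀ ht0] at h3
        have h4 := mul_le_mul_of_nonneg_right hk1 (hP a)
        linarith
    exact_mod_cast h1
  have hfin := logb_natCast_mono (codeNum_pow_le G hkm)
  rw [Nat.cast_pow, Real.logb_pow] at hfin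
  refine le_trans ?_ hfin
  have h5 : (k : ℝ) * (s * (γ - δ / 2)) ≤ k * Real.logb 2 (codeNum G n') :=
    mul_le_mul_of_nonneg_left hcode k.cast_nonneg
  refine le_trans ?_ h5
  have hc1 : 0 < γ - δ / 2 := by linarith
  have h6 := mul_lt_mul_of_pos_right hk2 hc1
  have h7 : (1 + η) * (t * (γ - δ)) ≤ (1 + η) * (k * (s * (γ - δ / 2))) := by
    have : t * κ = (1 - η) * t * (γ - δ / 2) - (1 + η) * (t * (γ - δ)) := by rw [hκ]; ring
    linarith
  exact le_of_mul_le_mul_left h7 (by linarith)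

omit [DecidableEq V] in
theorem eventually_abs_sub_lt_of_tendsto {P : V → ℝ} {q : ℕ → V → ℝ}
    (h : Tendsto q atTop (𝓝 P)) {ε : ℝ} (hε : 0 < ε) :
    ∀ᶠ t in atTop, ∀ a, |q t a - P a| < ε :=
  eventually_all.2 fun a =>
    (tendsto_pi_nhds.1 h a).eventually (Metric.ball_mem_nhds _ hε)

theorem eventually_nonempty_typicalSet {P : V → ℝ} (hP : ∀ a, 0 ≤ P a) (hPsum : ∑ a, P a = 1)
    {ε : ℝ} (hε : 0 < ε) : ∀ᶠ t : ℕ in atTop, (typicalSet P ε t).Nonempty := by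
  obtain ⟨n, hn, hlim⟩ := exists_types_tendsto hP hPsum
  filter_upwards [eventually_abs_sub_lt_of_tendsto hlim hε] with t ht
  obtain ⟨x, hx⟩ := exists_wordType_eq (ι := Fin t) (n := n t) (by simpa using hn t)
  exact ⟨x, by rw [mem_typicalSet, hx]; exact ht⟩

/-- Typical sets contain type classes of nearly maximal size. -/
theorem entropyTwo_le_add_typicalExponent (G : Digraph V) {P : V → ℝ} (hP : ∀ a, 0 ≤ P a)
    (hPsum : ∑ a, P a = 1) {ε : ℝ} (hε : 0 < ε) :
    (entropyTwo P : EReal) ≤ typicalExponent chromNum G P ε + typicalExponent indepNum G P ε := by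
  obtain ⟨n, hn, hlim⟩ := exists_types_tendsto hP hPsum
  have hb1 := limsup_logb_mem_Icc fun t => chromNum_le_card_pow G (typicalSet P ε t)
  have hb2 := limsup_logb_mem_Icc fun t => indepNum_le_card_pow G (typicalSet P ε t)
  have hl : Tendsto (fun t : ℕ => entropyTwo (fun a => (n t a : ℝ) / t) -
      (Fintype.card V * Real.logb 2 (Real.exp 1) + Fintype.card V * Real.logb 2 (t + 1)) / t)
      atTop (𝓝 (entropyTwo P)) := by
    simpa using ((continuous_entropyTwo.tendsto P).comp hlim).sub
      (tendsto_add_mul_logb_div (Fintype.card V * Real.logb 2 (Real.exp 1)) (Fintype.card V))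
  rw [← (EReal.tendsto_coe.2 hl).limsup_eq]
  refine (limsup_le_limsup ?_).trans (EReal.limsup_add_le
    (Or.inr (ne_top_of_le_ne_top (EReal.coe_ne_top _) hb2.2))
    (Or.inl (ne_top_of_le_ne_top (EReal.coe_ne_top _) hb1.2)))
  filter_upwards [eventually_abs_sub_lt_of_tendsto hlim hε, eventually_gt_atTop 0] with t ht ht0
  have ht' : (0 : ℝ) < t := by exact_mod_cast ht0
  rw [Pi.add_apply, ← EReal.coe_add]
  refine EReal.coe_le_coe ?_
  have h1 := card_le_chromNum_mul_indepNum G (typicalSet P ε t) (X := typeClass (Fin t) (n t))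
    fun x hx => by
      rw [mem_typicalSet, mem_typeClass.1 hx]
      exact ht
  have hX : 0 < #(typeClass (Fin t) (n t)) :=
    card_typeClass_pos (ι := Fin t) _ (by simpa using hn t)
  have hpos := Nat.lt_of_lt_of_le hX h1
  have h2 := logb_natCast_mono h1
  rw [Nat.cast_mul, Real.logb_mul (by exact_mod_cast (Nat.pos_of_mul_pos_right hpos).ne')
    (by exact_mod_cast (Nat.pos_of_mul_pos_left hpos).ne')] at h2
  have h3 := le_logb_card_typeClass (ι := Fin t) (n t) (by simpa using hn t) (by simpa using ht0)
  rw [Fintype.card_fin, Real.logb_mul (Real.exp_pos 1).ne' (by positivity)] at h3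
  rw [← add_div, le_div_iff₀ ht', sub_mul, div_mul_cancel₀ _ ht'.ne']
  linarith

/-- Covering each type class close to `P` by permuted copies of a maximal code in it bounds the
exponent of the chromatic number. -/
theorem exists_typicalExponent_chromNum_le (G : Digraph V) {P : V → ℝ} (hP : ∀ a, 0 ≤ P a)
    (hPsum : ∑ a, P a = 1) {γ : ℝ} (hγ : ∀ ε > 0, (γ : EReal) ≤ typicalExponent indepNum G P ε)
    {δ : ℝ} (hδ : 0 < δ) :
    ∃ ε > 0, typicalExponent chromNum G P ε ≤ ((entropyTwo P - γ + 3 * δ : ℝ) : EReal) := by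
  obtain ⟨ε₁, hε₁, T, hcode⟩ := exists_le_logb_codeNum G hP hPsum hγ hδ
  obtain ⟨ε₂, hε₂, hent⟩ := exists_pos_of_eventually_nhds
    ((continuous_entropyTwo.tendsto P).eventually_lt_const
      (show entropyTwo P < entropyTwo P + δ by linarith))
  obtain ⟨a₀⟩ : Nonempty V := by
    by_contra h
    rw [not_nonempty_iff] at h
    simp at hPsum
  have hV : (0 : ℝ) < Fintype.card V := by exact_mod_cast Fintype.card_pos_iff.2 ⟨a₀⟩
  refine ⟨min ε₁ ε₂, lt_min hε₁ hε₂, limsup_le_of_le (h := ?_)⟩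
  set ε := min ε₁ ε₂
  have hpoly := (tendsto_add_mul_logb_div (Real.logb 2 (Fintype.card V))
    (Fintype.card V + 1)).eventually_lt_const hδ
  filter_upwards [hpoly, eventually_gt_atTop 0,
    tendsto_natCast_atTop_atTop.eventually_ge_atTop T,
    eventually_nonempty_typicalSet hP hPsum (lt_min hε₁ hε₂)] with t hp ht0 htT hne
  have ht : (0 : ℝ) < t := by exact_mod_cast ht0
  refine EReal.coe_le_coe ?_
  rw [div_lt_iff₀ ht] at hp
  rw [div_le_iff₀ ht]
  set U := typicalSet P ε t
  set R : ℝ := entropyTwo P - γ + 2 * δ with hR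
  set K : ℝ := (2 : ℝ) ^ (t * R) * (Fintype.card V * (t + 1))
  -- All type classes in the typical set are covered by at most `K` codes each.
  have hcov : ∀ n : V → ℕ, ∃ C : Finset (Finset (Fin t → V)), (∀ B ∈ C, IsCode G B) ∧
      ((∃ x ∈ U, wordType x = n) → ∀ x ∈ typeClass (Fin t) n, ∃ B ∈ C, x ∈ B) ∧
      (#C : ℝ) ≤ K := by
    intro n
    by_cases hn : ∃ x ∈ U, wordType x = n
    swap
    · exact ⟨∅, by simp, fun h => absurd h hn, by simp only [card_empty, Nat.cast_zero]; positivity⟩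
    obtain ⟨x, hx, hxn⟩ := hn
    have hsum : ∑ a, n a = t := by rw [← hxn]; simpa using sum_wordType x
    have hnP : ∀ a, |(n a : ℝ) / t - P a| < ε := by rw [← hxn]; exact hx
    obtain ⟨A, hA, hAn, hAc⟩ :=
      exists_code_card_eq_codeNum G (ι := Fin t) (n := n) (by simpa using hsum)
    have hA0 : 0 < #A := by rw [hAc]; exact codeNum_pos G n
    obtain ⟨C, hC1, hC2, hC3⟩ := exists_cover_typeClass hA hAn (Finset.card_pos.1 hA0)
    refine ⟨C, hC1, fun _ => hC2, hC3.trans ?_⟩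
    have hA0' : (0 : ℝ) < #A := by exact_mod_cast hA0
    have hT0 : (0 : ℝ) < #(typeClass (Fin t) n) := by
      exact_mod_cast hA0.trans_le (Finset.card_le_card hAn)
    have hratio1 : 1 ≤ (#(typeClass (Fin t) n) : ℝ) / #A := by
      rw [one_le_div hA0']
      exact_mod_cast Finset.card_le_card hAn
    have hratio2 : (#(typeClass (Fin t) n) : ℝ) / #A ≤ (2 : ℝ) ^ (t * R) := by
      rw [← Real.logb_le_iff_le_rpow (by norm_num) (by positivity),
        Real.logb_div hT0.ne' hA0'.ne', hAc]
      have h1 := hcode t htT n hsum fun a => (hnP a).trans_le (min_le_left _ _)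
      have h2 := logb_card_typeClass_le (ι := Fin t) n (by simpa using hsum) (by simpa using ht0)
      rw [Fintype.card_fin] at h2
      have h3 := mul_lt_mul_of_pos_left (hent _ fun a => (hnP a).trans_le (min_le_right _ _)) ht
      have h4 : t * R = t * (entropyTwo P + δ) - t * (γ - δ) := by rw [hR]; ring
      linarith
    have hlog : Real.log #(typeClass (Fin t) n) ≤ t * Fintype.card V := by
      have h1 : (#(typeClass (Fin t) n) : ℝ) ≤ (Fintype.card V : ℝ) ^ t := by
        exact_mod_cast (Finset.card_le_univ (typeClass (Fin t) n)).trans (by simp)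
      refine (Real.log_le_log hT0 h1).trans ?_
      rw [Real.log_pow]
      exact mul_le_mul_of_nonneg_left (Real.log_le_self hV.le) ht.le
    have hV1 : (1 : ℝ) ≤ Fintype.card V := by
      exact_mod_cast Fintype.card_pos_iff.2 ⟨a₀⟩
    calc (#(typeClass (Fin t) n) : ℝ) / #A * Real.log #(typeClass (Fin t) n) + 1
        ≤ (#(typeClass (Fin t) n) : ℝ) / #A * (t * Fintype.card V) +
            (#(typeClass (Fin t) n) : ℝ) / #A * Fintype.card V := by
          refine add_le_add (mul_le_mul_of_nonneg_left hlog (by linarith)) ?_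
          exact one_le_mul_of_one_le_of_one_le hratio1 hV1
      _ = (#(typeClass (Fin t) n) : ℝ) / #A * (Fintype.card V * (t + 1)) := by ring
      _ ≤ K := mul_le_mul_of_nonneg_right hratio2 (by positivity)
  choose C hC1 hC2 hC3 using hcov
  have hχ : (chromNum ((G.andPow t).inducedOn U) : ℝ) ≤ (t + 1) ^ Fintype.card V * K := by
    have h1 := chromNum_le_of_cover (G := G) (U := U)
      ((Fintype.piFinset fun _ : V => range (t + 1)).biUnion C)
      (fun B hB => by
        obtain ⟨n, -, hn⟩ := Finset.mem_biUnion.1 hB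
        exact hC1 n B hn)
      (fun x hx => by
        obtain ⟨B, hB, hxB⟩ := hC2 (wordType x) ⟨x, hx, rfl⟩ x (mem_typeClass.2 rfl)
        exact ⟨B, Finset.mem_biUnion.2 ⟨_, wordType_mem_piFinset x, hB⟩, hxB⟩)
    calc (chromNum ((G.andPow t).inducedOn U) : ℝ)
        ≤ (∑ n ∈ Fintype.piFinset fun _ : V => range (t + 1), #(C n) : ℕ) := by
          exact_mod_cast h1.trans Finset.card_biUnion_le
      _ ≤ ∑ n ∈ Fintype.piFinset fun _ : V => range (t + 1), K := by
          push_cast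
          exact Finset.sum_le_sum fun n _ => hC3 n
      _ = (t + 1) ^ Fintype.card V * K := by
          rw [Finset.sum_const, card_piFinset_range, nsmul_eq_mul]
          push_cast
          rfl
  have hχ0 : 0 < chromNum ((G.andPow t).inducedOn U) := by
    obtain ⟨x, hx⟩ := hne
    have h1 := card_le_chromNum_mul_indepNum G U (X := {x}) (by simpa using hx)
    exact Nat.pos_of_mul_pos_right (Nat.lt_of_lt_of_le (by simp) h1)
  have hlog := Real.logb_le_logb_of_le (b := 2) (by norm_num) (by exact_mod_cast hχ0) hχ
  rw [Real.logb_mul (by positivity) (by positivity), Real.logb_pow,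
    Real.logb_mul (by positivity) (by positivity), Real.logb_rpow (by norm_num) (by norm_num),
    Real.logb_mul hV.ne' (by positivity)] at hlog
  have h5 : (entropyTwo P - γ + 3 * δ) * t = t * R + δ * t := by rw [hR]; ring
  linarith

end Rates

end Digraph

/-! ### The sum of the two rates -/

/-- For a loopless digraph `G` on a finite vertex set and a probability distribution `P` on it,
both limits defining the within-type parameters exist, and their values add up to the entropy. -/
theorem mainTheorem1 {V : Type*} [Fintype V] [DecidableEq V] (G : Digraph V)
    (hG : ∀ v, ¬ G.Adj v v) (P : V → ℝ) (hP : ∀ a, 0 ≤ P a) (hPsum : ∑ a, P a = 1) :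
    Tendsto (Digraph.typicalExponent Digraph.chromNum G P) (𝓝[>] (0 : ℝ))
        (𝓝 (G.dilworthRateWithin P)) ∧
      Tendsto (Digraph.typicalExponent Digraph.indepNum G P) (𝓝[>] (0 : ℝ))
        (𝓝 (G.spernerCapacityWithin P)) ∧
      G.dilworthRateWithin P + G.spernerCapacityWithin P = (Digraph.entropyTwo P : EReal) := by
  have hD := (Digraph.monotone_typicalExponent_chromNum G P).tendsto_nhdsGT 0
  have hΓ := (Digraph.monotone_typicalExponent_indepNum G P).tendsto_nhdsGT 0
  have hD' : G.dilworthRateWithin P = _ := hD.limUnder_eq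
  have hΓ' : G.spernerCapacityWithin P = _ := hΓ.limUnder_eq
  rw [← hD'] at hD
  rw [← hΓ'] at hΓ
  refine ⟨hD, hΓ, ?_⟩
  have hDle : ∀ ε > 0, G.dilworthRateWithin P ≤
      Digraph.typicalExponent Digraph.chromNum G P ε := fun ε hε => by
    rw [hD']; exact sInf_le ⟨ε, hε, rfl⟩
  have hΓle : ∀ ε > 0, G.spernerCapacityWithin P ≤
      Digraph.typicalExponent Digraph.indepNum G P ε := fun ε hε => by
    rw [hΓ']; exact sInf_le ⟨ε, hε, rfl⟩
  have finD : ∀ ε, _ := fun ε => Digraph.limsup_logb_mem_Icc fun t =>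
    Digraph.chromNum_le_card_pow G (Digraph.typicalSet P ε t)
  have finΓ : ∀ ε, _ := fun ε => Digraph.limsup_logb_mem_Icc fun t =>
    Digraph.indepNum_le_card_pow G (Digraph.typicalSet P ε t)
  -- Both rates are finite, so that no junk value of addition in `EReal` intervenes.
  have hD0 : ((0 : ℝ) : EReal) ≤ G.dilworthRateWithin P :=
    ge_of_tendsto' hD fun ε => (finD ε).1
  have hΓ0 : ((0 : ℝ) : EReal) ≤ G.spernerCapacityWithin P :=
    ge_of_tendsto' hΓ fun ε => (finΓ ε).1
  have hDtop := (hDle 1 one_pos).trans (finD 1).2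
  have hΓtop := (hΓle 1 one_pos).trans (finΓ 1).2
  obtain ⟨d, hd⟩ : ∃ d : ℝ, G.dilworthRateWithin P = d :=
    ⟨_, (EReal.coe_toReal (ne_top_of_le_ne_top (EReal.coe_ne_top _) hDtop)
      (ne_bot_of_le_ne_bot (EReal.coe_ne_bot _) hD0)).symm⟩
  obtain ⟨γ, hγ⟩ : ∃ γ : ℝ, G.spernerCapacityWithin P = γ :=
    ⟨_, (EReal.coe_toReal (ne_top_of_le_ne_top (EReal.coe_ne_top _) hΓtop)
      (ne_bot_of_le_ne_bot (EReal.coe_ne_bot _) hΓ0)).symm⟩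
  rw [hd] at hD hDle ⊢
  rw [hγ] at hΓ hΓle ⊢
  refine le_antisymm ?_ ?_
  · rw [← EReal.coe_add, EReal.coe_le_coe_iff]
    refine le_of_forall_pos_le_add fun δ hδ => ?_
    obtain ⟨ε, hε, hle⟩ := Digraph.exists_typicalExponent_chromNum_le G hP hPsum hΓle
      (show 0 < δ / 3 by positivity)
    have h1 := EReal.coe_le_coe_iff.1 ((hDle ε hε).trans hle)
    linarith
  · have hadd := (EReal.continuousAt_add (p := ((d : EReal), (γ : EReal)))
      (Or.inl (EReal.coe_ne_top d)) (Or.inl (EReal.coe_ne_bot d))).tendsto.comp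
      (hD.prodMk_nhds hΓ)
    refine ge_of_tendsto hadd ?_
    filter_upwards [self_mem_nhdsWithin] with ε hε
    exact Digraph.entropyTwo_le_add_typicalExponent G hP hPsum hε
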